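/- Identify $\mathbb{C}^3$ with the Euclidean space $\mathbb{R}^6$. A smooth oriented embedded real 3-dimensional submanifold of $\mathbb{C}^3$ is called special Lagrangian if $\mathrm{Re}(dz^1\wedge dz^2\wedge dz^3)$ restricts to its Riemannian volume form. For $\Sigma\subset S^5=\{z\in\mathbb{C}^3:|z|=1\}$ let $C(\Sigma)=\{tx : t\ge 0,\ x\in\Sigma\}$; a set of the form $C=C(\Sigma)$ is a special Lagrangian cone with link $\Sigma=C\cap S^5$ if $C\setminus\{0\}$ is (for a suitable orientation) a special Lagrangian submanifold. There exists a countably infinite family $(C_k)_{k\in\mathbb{N}}$ of special Lagrangian cones in $\mathbb{C}^3$ such that: (1) for every $k$, the link $C_k\cap S^5$ is a smoothly embedded 2-torus, i.e. the image of $S^1\times S^1$ under a smooth embedding; (2) for every $k$, the link $C_k\cap S^5$ is invariant under a circle subgroup of $\mathrm{SU}(3)$, i.e. under the image of an injective continuous homomorphism $S^1\to\mathrm{SU}(3)$ (which may depend on $k$); (3) the cones are pairwise non-isometric: for $j\ne k$ there is no Riemannian isometry (metric-preserving diffeomorphism) from $C_j\setminus\{0\}$ onto $C_k\setminus\{0\}$,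 both with the metric induced from $\mathbb{R}^6$. -/

import Mathlib

open scoped Manifold ContDiff

noncomputable section

/-- `ℂ³` with its standard Hermitian norm, regarded below also as the Euclidean space `ℝ⁶`. -/
abbrev C3 : Type := EuclideanSpace ℂ (Fin 3)

/-- `φ : U → M` is a smooth local parametrization of `M ⊆ ℂ³ = ℝ⁶` as an embedded
3-dimensional submanifold: an immersion that is a homeomorphism onto an open subset of `M`. -/
structure IsLocalParam (M : Set C3) (U : Set (EuclideanSpace ℝ (Fin 3)))
    (φ : EuclideanSpace ℝ (Fin 3) → C3) : Prop where
  isOpen_domain : IsOpen U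
  smooth : ContDiffOn ℝ ∞ φ U
  immersion : ∀ x ∈ U, Function.Injective (fderiv ℝ φ x)
  embedding : Topology.IsEmbedding (U.domRestrict φ)
  open_image : ∃ W : Set C3, IsOpen W ∧ φ '' U = M ∩ W

/-- The `i`-th coordinate vector field `∂φ/∂xᵢ` of a parametrization. -/
def coordVec (φ : EuclideanSpace ℝ (Fin 3) → C3) (x : EuclideanSpace ℝ (Fin 3)) (i : Fin 3) : C3 :=
  fderiv ℝ φ x (EuclideanSpace.single i 1)

/-- `Re (dz¹ ∧ dz² ∧ dz³)` evaluated on three vectors: the special Lagrangian calibration. -/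
def reOmega (v : Fin 3 → C3) : ℝ :=
  (Matrix.det (Matrix.of fun i j => v j i)).re

/-- The Euclidean 3-volume of the parallelepiped spanned by three vectors of `ℂ³ = ℝ⁶`, that is,
the norm of `v₀ ∧ v₁ ∧ v₂` for the real inner product `Re ⟨·,·⟩`. -/
def vol3 (v : Fin 3 → C3) : ℝ :=
  √(Matrix.det (Matrix.of fun i j => (inner ℂ (v i) (v j)).re))

/-- `M` is a (smooth, embedded, oriented) special Lagrangian submanifold of `ℂ³`: it is covered by
local parametrizations in which the calibration `Re (dz¹ ∧ dz² ∧ dz³)` restricts to the volume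
form of the induced metric. Such parametrizations automatically overlap with positive Jacobian,
as the same 3-form is positive in each, so they form an oriented atlas; `M` carries the orientation
they define, and its oriented tangent planes are calibrated. -/
def IsSpecialLagrangian (M : Set C3) : Prop :=
  ∀ p ∈ M, ∃ (U : Set (EuclideanSpace ℝ (Fin 3))) (φ : EuclideanSpace ℝ (Fin 3) → C3),
    IsLocalParam M U φ ∧ p ∈ φ '' U ∧ ∀ x ∈ U, reOmega (coordVec φ x) = vol3 (coordVec φ x)

/-- The cone `{t x : t ≥ 0, x ∈ S}`. -/
def coneOn (S : Set C3) : Set C3 := {y | ∃ t : ℝ, 0 ≤ t ∧ ∃ x ∈ S, y = t • x}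

/-- The link `C ∩ S⁵` of a cone `C`. -/
def link (C : Set C3) : Set C3 := C ∩ Metric.sphere 0 1

/-- `C` is the cone on its link and is special Lagrangian away from the vertex. -/
def IsSpecialLagrangianCone (C : Set C3) : Prop :=
  C = coneOn (link C) ∧ IsSpecialLagrangian (C \ {0})

/-- `S` is a smoothly embedded 2-torus: the image of `S¹ × S¹` under a smooth immersion that is a
homeomorphism onto its image. -/
def IsEmbeddedTorus (S : Set C3) : Prop :=
  ∃ F : Circle × Circle → C3,
    ContMDiff ((𝓡 1).prod (𝓡 1)) 𝓘(ℝ, C3) ∞ F ∧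
    (∀ x, Function.Injective (mfderiv ((𝓡 1).prod (𝓡 1)) 𝓘(ℝ, C3) F x)) ∧
    Topology.IsEmbedding F ∧ Set.range F = S

/-- `S` is invariant under a circle subgroup of `SU(3)`, namely the image of an injective
continuous homomorphism `S¹ → SU(3)`. -/
def IsCircleInvariant (S : Set C3) : Prop :=
  ∃ ρ : Circle →* Matrix.specialUnitaryGroup (Fin 3) ℂ,
    Continuous ρ ∧ Function.Injective ρ ∧
    ∀ w : Circle, (fun x : C3 => Matrix.toEuclideanLin (ρ w : Matrix (Fin 3) (Fin 3) ℂ) x) '' S = S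

/-- `f` maps the submanifold `M` into `N`, smoothly and preserving the induced Riemannian metrics
(both read off in local parametrizations of `M`). -/
def IsMetricPreserving (f : C3 → C3) (M N : Set C3) : Prop :=
  Set.MapsTo f M N ∧ ∀ U φ, IsLocalParam M U φ →
    ContDiffOn ℝ ∞ (f ∘ φ) U ∧ ∀ x ∈ U, ∀ v, ‖fderiv ℝ (f ∘ φ) x v‖ = ‖fderiv ℝ φ x v‖

/-- The submanifolds `M` and `N`, with the Riemannian metrics induced from `ℂ³ = ℝ⁶`, are
isometric: there is a diffeomorphism between them preserving the metrics. -/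
def AreIsometric (M N : Set C3) : Prop :=
  ∃ f g : C3 → C3, IsMetricPreserving f M N ∧ IsMetricPreserving g N M ∧ Set.InvOn g f M N

end

open Complex Set Topology
open scoped ComplexConjugate

noncomputable section

/-! ### The family of cones -/

/-! Take the circle in SU(3) with weights (m + 1, m, -(2m + 1)) and sweep the real quadratic cone (m
+ 1) x² + m y² = (2m + 1) h², with its last axis turned by i, along the circle. The quadratic
equation says that the moment map vanishes, so the sweep is Lagrangian. The weights sum to zero, so
the phase of dz¹ ∧ dz² ∧ dz³ is constant, and the factor i makes it real and positive
(`reOmega_coordVec_coneChart`). With h > 0 the pair (w, U) is a global coordinate system away from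
the vertex, inverted smoothly by `orbitBase` and `orbitAngle`; this yields both the charts and the
embedded torus link.

The cones are told apart without computing an invariant. An isometry preserves the distance to the
vertex, because the image of a radial segment has finite length and can only end at the vertex
(`norm_map_le`, `norm_map_eq`). In the k-th cone a point at distance r moving with speed v changes U
at rate at most v / (k r) (`mul_norm_deriv_orbitAngle_le`), so passing from U = 1 to U = -1 is long
when k is large. In a fixed cone, any two points of the link are joined by a path of bounded length
that stays away from the vertex. Hence a fixed cone is isometric to only finitely many others
(`exists_bound_of_areIsometric`), and a pairwise non-isometric sequence can be chosen. -/

/-- The positive solution `h` of `(m + 1) x² + m y² = (2m + 1) h²`, where `w = x + i y`. -/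
def coneHeight (m : ℕ) (w : ℂ) : ℝ :=
  √(((m + 1) * w.re ^ 2 + m * w.im ^ 2) / (2 * m + 1))

/-- The orbit map of the circle action with weights `(m + 1, m, -(2m + 1))` over the quadratic
cone `(m + 1) x² + m y² = (2m + 1) h²`; the last coordinate is rotated by `i`. -/
def coneMap (m : ℕ) (w U : ℂ) : C3 :=
  !₂[U ^ (m + 1) * w.re, U ^ m * w.im, I * conj U ^ (2 * m + 1) * coneHeight m w]

/-- The image of `coneMap m` over the unit circle. -/
def torusCone (m : ℕ) : Set C3 := {z | ∃ w U : ℂ, ‖U‖ = 1 ∧ z = coneMap m w U}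

/-- A smooth extension to a neighbourhood of the function `coneMap m w U ↦ U`. -/
def orbitAngle (z : C3) : ℂ :=
  ((z 0) ^ 2 * (-I * z 2 / ‖z 2‖) + conj ((z 1) ^ 2 * (-I * z 2 / ‖z 2‖))) /
    (normSq (z 0) + normSq (z 1) : ℝ)

/-- A smooth extension to a neighbourhood of the function `coneMap m w U ↦ w`. -/
def orbitBase (m : ℕ) (z : C3) : ℂ :=
  z 0 * conj (orbitAngle z) ^ (m + 1) + I * (z 1 * conj (orbitAngle z) ^ m)

/-- The domain on which `orbitAngle` and `orbitBase` are smooth. -/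
def regularSet : Set C3 := {z | z 2 ≠ 0 ∧ normSq (z 0) + normSq (z 1) ≠ 0}

@[simp] lemma coneMap_zero_apply (m : ℕ) (w U : ℂ) : coneMap m w U 0 = U ^ (m + 1) * w.re := rfl

@[simp] lemma coneMap_one_apply (m : ℕ) (w U : ℂ) : coneMap m w U 1 = U ^ m * w.im := rfl

@[simp] lemma coneMap_two_apply (m : ℕ) (w U : ℂ) :
    coneMap m w U 2 = I * conj U ^ (2 * m + 1) * coneHeight m w := rfl

lemma coneHeight_sq (m : ℕ) (w : ℂ) :
    (2 * m + 1) * coneHeight m w ^ 2 = (m + 1) * w.re ^ 2 + m * w.im ^ 2 := by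
  rw [coneHeight, Real.sq_sqrt (by positivity)]
  field_simp

/-- Both coefficients have to be positive: for `m = 0` the height is |re w|, which is neither
positive nor smooth on the imaginary axis. -/
lemma coneHeight_arg_pos {m : ℕ} (hm : 0 < m) {w : ℂ} (hw : w ≠ 0) :
    0 < ((m + 1) * w.re ^ 2 + m * w.im ^ 2) / (2 * (m : ℝ) + 1) := by
  have hm' : (0 : ℝ) < m := by exact_mod_cast hm
  have h : 0 < w.re ^ 2 + w.im ^ 2 := by
    have := normSq_pos.2 hw
    rw [normSq_apply] at this
    linarith
  have : 0 < (m + 1) * w.re ^ 2 + m * w.im ^ 2 := by nlinarith [sq_nonneg w.re, mul_pos hm' h]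
  positivity

lemma coneHeight_pos {m : ℕ} (hm : 0 < m) {w : ℂ} (hw : w ≠ 0) : 0 < coneHeight m w :=
  Real.sqrt_pos.2 (coneHeight_arg_pos hm hw)

lemma coneHeight_smul (m : ℕ) {r : ℝ} (hr : 0 ≤ r) (w : ℂ) :
    coneHeight m (r * w) = r * coneHeight m w := by
  rw [coneHeight, coneHeight, ← Real.sqrt_sq hr, ← Real.sqrt_mul (sq_nonneg _), Real.sqrt_sq hr]
  congr 1
  simp
  ring

lemma coneMap_smul (m : ℕ) {r : ℝ} (hr : 0 ≤ r) (w U : ℂ) :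
    coneMap m (r * w) U = r • coneMap m w U := by
  ext i
  fin_cases i <;> simp [coneHeight_smul m hr] <;> ring

lemma coneMap_mul (m : ℕ) (w U : ℂ) (ζ : ℂ) :
    coneMap m w (ζ * U) = !₂[ζ ^ (m + 1) * coneMap m w U 0, ζ ^ m * coneMap m w U 1,
      conj ζ ^ (2 * m + 1) * coneMap m w U 2] := by
  ext i
  fin_cases i <;> simp <;> ring

lemma continuous_coneHeight (m : ℕ) : Continuous (coneHeight m) := by
  unfold coneHeight
  fun_prop

lemma continuous_coneMap (m : ℕ) : Continuous fun p : ℂ × ℂ => coneMap m p.1 p.2 := by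
  have := continuous_coneHeight m
  refine (PiLp.continuous_toLp 2 _).comp (continuous_pi fun i => ?_)
  fin_cases i <;> simp <;> fun_prop

lemma norm_sq_coneMap (m : ℕ) (w : ℂ) {U : ℂ} (hU : ‖U‖ = 1) :
    ‖coneMap m w U‖ ^ 2 = ‖w‖ ^ 2 + coneHeight m w ^ 2 := by
  rw [EuclideanSpace.norm_sq_eq, Fin.sum_univ_three, Complex.sq_norm w, normSq_apply]
  simp [hU]
  ring

lemma norm_le_norm_coneMap (m : ℕ) (w : ℂ) {U : ℂ} (hU : ‖U‖ = 1) : ‖w‖ ≤ ‖coneMap m w U‖ := by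
  have := norm_sq_coneMap m w hU
  exact le_of_sq_le_sq (by nlinarith [sq_nonneg (coneHeight m w)]) (norm_nonneg _)

/-- Both coefficients m + 1 and m are at most 2m + 1, so the height is at most ‖w‖; the constant 2
is a crude substitute for √2. -/
lemma norm_coneMap_le (m : ℕ) (w : ℂ) {U : ℂ} (hU : ‖U‖ = 1) :
    ‖coneMap m w U‖ ≤ 2 * ‖w‖ := by
  have h := norm_sq_coneMap m w hU
  have h1 := coneHeight_sq m w
  have h2 : ‖w‖ ^ 2 = w.re ^ 2 + w.im ^ 2 := by rw [Complex.sq_norm w, normSq_apply]; ring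
  refine le_of_sq_le_sq ?_ (by positivity)
  have hm : (0 : ℝ) ≤ m := by positivity
  have : coneHeight m w ^ 2 ≤ ‖w‖ ^ 2 := by
    rw [h2]
    have : (2 * (m : ℝ) + 1) * coneHeight m w ^ 2 ≤ (2 * m + 1) * (w.re ^ 2 + w.im ^ 2) := by
      rw [h1]
      nlinarith [mul_nonneg hm (sq_nonneg w.re), mul_nonneg hm (sq_nonneg w.im), sq_nonneg w.im]
    exact le_of_mul_le_mul_left this (by positivity)
  nlinarith [sq_nonneg ‖w‖]

lemma coneMap_ne_zero (m : ℕ) {w U : ℂ} (hw : w ≠ 0) (hU : ‖U‖ = 1) : coneMap m w U ≠ 0 := by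
  intro h
  have := norm_le_norm_coneMap m w hU
  rw [h, norm_zero] at this
  exact hw (norm_le_zero_iff.1 this)

lemma coneMap_zero (m : ℕ) (U : ℂ) : coneMap m 0 U = 0 := by
  simpa using coneMap_smul m le_rfl 0 U

lemma mem_torusCone_diff {m : ℕ} {z : C3} :
    z ∈ torusCone m \ {0} ↔ ∃ w U : ℂ, w ≠ 0 ∧ ‖U‖ = 1 ∧ z = coneMap m w U := by
  constructor
  · rintro ⟨⟨w, U, hU, rfl⟩, h0⟩
    refine ⟨w, U, ?_, hU, rfl⟩
    rintro rfl
    exact h0 (coneMap_zero m U)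
  · rintro ⟨w, U, hw, hU, rfl⟩
    exact ⟨⟨w, U, hU, rfl⟩, coneMap_ne_zero m hw hU⟩

lemma conj_mul_self_of_norm {U : ℂ} (hU : ‖U‖ = 1) : conj U * U = 1 := by
  rw [mul_comm, mul_conj, normSq_eq_norm_sq, hU]
  simp

lemma coneMap_mem_regularSet {m : ℕ} (hm : 0 < m) {w U : ℂ} (hw : w ≠ 0) (hU : ‖U‖ = 1) :
    coneMap m w U ∈ regularSet := by
  have hU0 : U ≠ 0 := by rintro rfl; simp at hU
  have hh := (coneHeight_pos hm hw).ne'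
  refine ⟨by simp [hU0, hh], ?_⟩
  have : normSq U = 1 := by rw [normSq_eq_norm_sq, hU, one_pow]
  have h := (normSq_pos.2 hw).ne'
  rw [normSq_apply] at h
  simpa [this] using h

/-- Since the height is positive, -i z₂ / |z₂| is the pure phase conj U ^ (2m + 1). Against z₀² it
leaves x² U, and against z₁² it leaves y² conj U, whence the conjugate in the definition; the
denominator is x² + y². -/
lemma orbitAngle_coneMap {m : ℕ} (hm : 0 < m) {w U : ℂ} (hw : w ≠ 0) (hU : ‖U‖ = 1) :
    orbitAngle (coneMap m w U) = U := by
  have hUU := conj_mul_self_of_norm hU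
  have hh := coneHeight_pos hm hw
  have hh' : (coneHeight m w : ℂ) ≠ 0 := by exact_mod_cast hh.ne'
  have hreg := (coneMap_mem_regularSet hm hw hU).2
  have hn : normSq U = 1 := by rw [normSq_eq_norm_sq, hU, one_pow]
  have hphase : -I * coneMap m w U 2 / ‖coneMap m w U 2‖ = conj U ^ (2 * m + 1) := by
    have : ‖coneMap m w U 2‖ = coneHeight m w := by simp [hU, abs_of_pos hh]
    rw [this, coneMap_two_apply]
    field_simp
    linear_combination (-conj U ^ (2 * m + 1)) * I_sq
  rw [orbitAngle, hphase, div_eq_iff (by exact_mod_cast hreg)]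
  simp only [coneMap_zero_apply, coneMap_one_apply, map_mul, map_pow, conj_conj, conj_ofReal, hn,
    normSq_ofReal]
  have e1 : (U ^ (m + 1)) ^ 2 * conj U ^ (2 * m + 1) = U := by
    calc _ = (conj U * U) ^ (2 * m + 1) * U := by ring
      _ = U := by rw [hUU]; simp
  have e2 : (conj U ^ m) ^ 2 * U ^ (2 * m + 1) = U := by
    calc _ = (conj U * U) ^ (2 * m) * U := by ring
      _ = U := by rw [hUU]; simp
  push_cast
  linear_combination (w.re : ℂ) ^ 2 * e1 + (w.im : ℂ) ^ 2 * e2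

lemma orbitBase_coneMap {m : ℕ} (hm : 0 < m) {w U : ℂ} (hw : w ≠ 0) (hU : ‖U‖ = 1) :
    orbitBase m (coneMap m w U) = w := by
  have hUU := conj_mul_self_of_norm hU
  rw [orbitBase, orbitAngle_coneMap hm hw hU, coneMap_zero_apply, coneMap_one_apply]
  have e1 : U ^ (m + 1) * conj U ^ (m + 1) = 1 := by
    rw [← mul_pow, mul_comm, hUU, one_pow]
  have e2 : U ^ m * conj U ^ m = 1 := by
    rw [← mul_pow, mul_comm, hUU, one_pow]
  conv_rhs => rw [← re_add_im w]
  linear_combination (w.re : ℂ) * e1 + (w.im : ℂ) * I * e2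

/-! ### Smoothness of the orbit map and of its inverse. -/

lemma contDiff_conj : ContDiff ℝ ∞ fun z : ℂ => conj z := conjCLE.contDiff

lemma contDiff_apply_C3 (i : Fin 3) : ContDiff ℝ ∞ fun z : C3 => z i :=
  (contDiff_piLp 2).1 contDiff_id i

lemma HasDerivAt.apply_C3 {z : ℝ → C3} {z' : C3} {τ : ℝ} (h : HasDerivAt z z' τ) (i : Fin 3) :
    HasDerivAt (fun τ => z τ i) (z' i) τ :=
  ((EuclideanSpace.proj i : C3 →L[ℂ] ℂ).restrictScalars ℝ).hasFDerivAt.comp_hasDerivAt τ h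

lemma contDiff_ofReal : ContDiff ℝ ∞ fun x : ℝ => (x : ℂ) := ofRealCLM.contDiff

lemma contDiff_normSq : ContDiff ℝ ∞ fun z : ℂ => normSq z := by
  simp only [normSq_eq_norm_sq]
  exact contDiff_norm_sq ℝ

lemma isOpen_regularSet : IsOpen regularSet := by
  have h0 := (contDiff_apply_C3 0).continuous
  have h1 := (contDiff_apply_C3 1).continuous
  have h2 := (contDiff_apply_C3 2).continuous
  exact (isOpen_ne_fun h2 continuous_const).inter (isOpen_ne_fun
    ((contDiff_normSq.continuous.comp h0).add (contDiff_normSq.continuous.comp h1))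
    continuous_const)

lemma contDiffAt_orbitAngle {z : C3} (hz : z ∈ regularSet) : ContDiffAt ℝ ∞ orbitAngle z := by
  have h (i) : ContDiffAt ℝ ∞ (fun z : C3 => z i) z := (contDiff_apply_C3 i).contDiffAt
  have hph : ContDiffAt ℝ ∞ (fun z : C3 => -I * z 2 / ‖z 2‖) z :=
    (contDiffAt_const.mul (h 2)).mul
      ((contDiff_ofReal.contDiffAt.comp z ((h 2).norm ℝ hz.1)).inv (by simpa using hz.1))
  refine ContDiffAt.mul ?_ (ContDiffAt.inv ?_ ?_)
  · exact (((h 0).pow 2).mul hph).add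
      (contDiff_conj.contDiffAt.comp z (((h 1).pow 2).mul hph))
  · exact contDiff_ofReal.contDiffAt.comp z
      ((contDiff_normSq.contDiffAt.comp z (h 0)).add (contDiff_normSq.contDiffAt.comp z (h 1)))
  · exact_mod_cast hz.2

lemma contDiffAt_orbitBase (m : ℕ) {z : C3} (hz : z ∈ regularSet) :
    ContDiffAt ℝ ∞ (orbitBase m) z := by
  have h (i) : ContDiffAt ℝ ∞ (fun z : C3 => z i) z := (contDiff_apply_C3 i).contDiffAt
  have hc : ContDiffAt ℝ ∞ (fun z => conj (orbitAngle z)) z :=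
    contDiff_conj.contDiffAt.comp z (contDiffAt_orbitAngle hz)
  exact ((h 0).mul (hc.pow _)).add (contDiffAt_const.mul ((h 1).mul (hc.pow _)))

lemma contDiffAt_coneHeight {m : ℕ} (hm : 0 < m) {w : ℂ} (hw : w ≠ 0) :
    ContDiffAt ℝ ∞ (coneHeight m) w := by
  refine ContDiffAt.sqrt ?_ (coneHeight_arg_pos hm hw).ne'
  have hre : ContDiff ℝ ∞ fun w : ℂ => w.re := reCLM.contDiff
  have him : ContDiff ℝ ∞ fun w : ℂ => w.im := imCLM.contDiff
  fun_prop

lemma contDiffAt_coneMap {m : ℕ} (hm : 0 < m) {p : ℂ × ℂ} (hp : p.1 ≠ 0) :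
    ContDiffAt ℝ ∞ (fun p : ℂ × ℂ => coneMap m p.1 p.2) p := by
  have hre : ContDiff ℝ ∞ fun p : ℂ × ℂ => (p.1.re : ℂ) :=
    contDiff_ofReal.comp (reCLM.contDiff.comp contDiff_fst)
  have him : ContDiff ℝ ∞ fun p : ℂ × ℂ => (p.1.im : ℂ) :=
    contDiff_ofReal.comp (imCLM.contDiff.comp contDiff_fst)
  have hh : ContDiffAt ℝ ∞ (fun p : ℂ × ℂ => (coneHeight m p.1 : ℂ)) p :=
    contDiff_ofReal.contDiffAt.comp p ((contDiffAt_coneHeight hm hp).comp p contDiffAt_fst)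
  have hc : ContDiffAt ℝ ∞ (fun p : ℂ × ℂ => conj p.2) p :=
    contDiff_conj.contDiffAt.comp p contDiffAt_snd
  refine (contDiffAt_piLp 2).2 fun i => ?_
  fin_cases i
  · exact (contDiffAt_snd.pow _).mul hre.contDiffAt
  · exact (contDiffAt_snd.pow _).mul him.contDiffAt
  · exact (contDiffAt_const.mul (hc.pow _)).mul hh

/-! ### Special Lagrangian charts -/

/-- Three vectors with real Hermitian products and real nonnegative complex determinant are
calibrated. -/
lemma reOmega_eq_vol3 {v : Fin 3 → C3} {r : ℝ} (hr : 0 ≤ r)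
    (hv : ∀ i j, (inner ℂ (v i) (v j)).im = 0)
    (hdet : Matrix.det (Matrix.of fun i j => v j i) = r) : reOmega v = vol3 v := by
  set M : Matrix (Fin 3) (Fin 3) ℂ := Matrix.of fun i j => v j i with hM
  set G : Matrix (Fin 3) (Fin 3) ℝ := Matrix.of fun i j => (inner ℂ (v i) (v j)).re with hG
  -- Reality of the Hermitian products makes the real Gram matrix equal to M* M, so its determinant
  -- is |det M|² = r².
  have hGM : G.map ofRealHom = M.conjTranspose * M := by
    ext i j
    have h1 : ((G i j : ℝ) : ℂ) = inner ℂ (v i) (v j) :=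
      Complex.ext (by simp [hG]) (by simp [hv i j])
    rw [Matrix.map_apply, ofRealHom_eq_coe, h1, Matrix.mul_apply, PiLp.inner_apply]
    simp [hM, mul_comm]
  have hdetG : ((G.det : ℝ) : ℂ) = ((r ^ 2 : ℝ) : ℂ) := by
    have := congrArg Matrix.det hGM
    rw [← RingHom.mapMatrix_apply, ← RingHom.map_det, Matrix.det_mul, Matrix.det_conjTranspose,
      hdet] at this
    simpa [sq] using this
  have hdetG' : G.det = r ^ 2 := by exact_mod_cast hdetG
  rw [reOmega, vol3, ← hM, ← hG, hdet, hdetG', Real.sqrt_sq hr, ofReal_re]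

/-- The first two real coordinates as a complex number. -/
def planeCoord (y : EuclideanSpace ℝ (Fin 3)) : ℂ := y 0 + y 1 * I

/-- The local parametrizations of `torusCone m`. -/
def coneChart (m : ℕ) (y : EuclideanSpace ℝ (Fin 3)) : C3 :=
  coneMap m (planeCoord y) (exp (y 2 * I))

/-- A domain of injectivity of `coneChart m`. -/
def chartDomain (t : ℝ) : Set (EuclideanSpace ℝ (Fin 3)) :=
  {y | planeCoord y ≠ 0 ∧ |y 2 - t| < Real.pi}

/-- A left inverse of `coneChart m` on `chartDomain t`. -/
def chartInv (m : ℕ) (t : ℝ) (z : C3) : EuclideanSpace ℝ (Fin 3) :=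
  !₂[(orbitBase m z).re, (orbitBase m z).im, t + arg (orbitAngle z * exp (-t * I))]

/-- An open set that meets the punctured cone in the image of `chartDomain t`. -/
def chartTarget (t : ℝ) : Set C3 := regularSet ∩ {z | orbitAngle z * exp (-t * I) ∈ slitPlane}

@[simp] lemma planeCoord_re (y : EuclideanSpace ℝ (Fin 3)) : (planeCoord y).re = y 0 := by
  simp [planeCoord]

@[simp] lemma planeCoord_im (y : EuclideanSpace ℝ (Fin 3)) : (planeCoord y).im = y 1 := by
  simp [planeCoord]

lemma contDiff_planeCoord : ContDiff ℝ ∞ planeCoord := by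
  have h (i) : ContDiff ℝ ∞ fun y : EuclideanSpace ℝ (Fin 3) => (y i : ℂ) :=
    contDiff_ofReal.comp ((contDiff_piLp 2).1 contDiff_id i)
  exact (h 0).add ((h 1).mul contDiff_const)

lemma contDiffAt_coneChart {m : ℕ} (hm : 0 < m) {y : EuclideanSpace ℝ (Fin 3)}
    (hy : planeCoord y ≠ 0) : ContDiffAt ℝ ∞ (coneChart m) y := by
  have h : ContDiff ℝ ∞ fun y : EuclideanSpace ℝ (Fin 3) => exp (y 2 * I) :=
    ((contDiff_ofReal.comp ((contDiff_piLp 2).1 contDiff_id 2)).mul contDiff_const).cexp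
  exact ContDiffAt.comp (g := fun p : ℂ × ℂ => coneMap m p.1 p.2) y
    (contDiffAt_coneMap hm (p := (planeCoord y, exp (y 2 * I))) hy)
    (contDiff_planeCoord.prodMk h).contDiffAt

lemma isOpen_chartDomain (t : ℝ) : IsOpen (chartDomain t) := by
  have h2 : Continuous fun y : EuclideanSpace ℝ (Fin 3) => |y 2 - t| := by fun_prop
  exact (isOpen_ne_fun contDiff_planeCoord.continuous continuous_const).inter
    (isOpen_lt h2 continuous_const)

lemma isOpen_chartTarget (t : ℝ) : IsOpen (chartTarget t) :=
  ContinuousOn.isOpen_inter_preimage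
    (fun _ hz => ((contDiffAt_orbitAngle hz).continuousAt.mul
      continuousAt_const).continuousWithinAt)
    isOpen_regularSet isOpen_slitPlane

lemma continuousAt_chartInv (m : ℕ) {t : ℝ} {z : C3} (hz : z ∈ chartTarget t) :
    ContinuousAt (chartInv m t) z := by
  have hb := (contDiffAt_orbitBase m hz.1).continuousAt
  have ha := (contDiffAt_orbitAngle hz.1).continuousAt
  refine (PiLp.continuous_toLp 2 _).continuousAt.comp (continuousAt_pi.2 fun i => ?_)
  fin_cases i
  · exact continuous_re.continuousAt.comp hb
  · exact continuous_im.continuousAt.comp hb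
  · exact continuousAt_const.add
      ((continuousAt_arg hz.2).comp (f := fun z => orbitAngle z * exp (-t * I))
        (ha.mul continuousAt_const))

lemma arg_exp_mul_I_of_abs_lt {θ : ℝ} (h : |θ| < Real.pi) : arg (exp (θ * I)) = θ := by
  rw [exp_mul_I, arg_cos_add_sin_mul_I]
  exact ⟨(abs_lt.1 h).1, (abs_lt.1 h).2.le⟩

lemma exp_mul_exp_neg (s t : ℝ) : exp (s * I) * exp (-t * I) = exp ((s - t : ℝ) * I) := by
  rw [← Complex.exp_add]
  congr 1
  push_cast
  ring

lemma chartInv_coneChart {m : ℕ} (hm : 0 < m) {t : ℝ} {y : EuclideanSpace ℝ (Fin 3)}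
    (hy : y ∈ chartDomain t) : chartInv m t (coneChart m y) = y := by
  have hU : ‖exp (y 2 * I)‖ = 1 := norm_exp_ofReal_mul_I _
  ext i
  fin_cases i
  · simp [chartInv, coneChart, orbitBase_coneMap hm hy.1 hU]
  · simp [chartInv, coneChart, orbitBase_coneMap hm hy.1 hU]
  · simp [chartInv, coneChart, orbitAngle_coneMap hm hy.1 hU, -neg_mul, exp_mul_exp_neg,
      arg_exp_mul_I_of_abs_lt hy.2, -ofReal_sub]

lemma coneChart_mem_chartTarget {m : ℕ} (hm : 0 < m) {t : ℝ} {y : EuclideanSpace ℝ (Fin 3)}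
    (hy : y ∈ chartDomain t) : coneChart m y ∈ chartTarget t := by
  have hU : ‖exp (y 2 * I)‖ = 1 := norm_exp_ofReal_mul_I _
  refine ⟨coneMap_mem_regularSet hm hy.1 hU, ?_⟩
  rw [mem_ofPred_eq, coneChart, orbitAngle_coneMap hm hy.1 hU, exp_mul_exp_neg,
    mem_slitPlane_iff_arg, arg_exp_mul_I_of_abs_lt hy.2]
  exact ⟨(abs_lt.1 hy.2).2.ne, exp_ne_zero _⟩

lemma coneChart_mem_torusCone (m : ℕ) {y : EuclideanSpace ℝ (Fin 3)} (hy : planeCoord y ≠ 0) :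
    coneChart m y ∈ torusCone m \ {0} :=
  mem_torusCone_diff.2 ⟨_, _, hy, norm_exp_ofReal_mul_I _, rfl⟩

/-- The right-inverse half: it identifies the image of a chart with the whole intersection of the
punctured cone and an open set. -/
lemma chartInv_mem_chartDomain {m : ℕ} (hm : 0 < m) {t : ℝ} {z : C3}
    (hz : z ∈ torusCone m \ {0}) (hzt : z ∈ chartTarget t) :
    chartInv m t z ∈ chartDomain t ∧ coneChart m (chartInv m t z) = z := by
  obtain ⟨w, U, hw, hU, rfl⟩ := mem_torusCone_diff.1 hz
  have hs := hzt.2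
  rw [mem_ofPred_eq, orbitAngle_coneMap hm hw hU] at hs
  have hw' : planeCoord (chartInv m t (coneMap m w U)) = w :=
    Complex.ext (by simp [chartInv, orbitBase_coneMap hm hw hU])
      (by simp [chartInv, orbitBase_coneMap hm hw hU])
  have h2 : chartInv m t (coneMap m w U) 2 = t + arg (U * exp (-t * I)) := by
    simp [chartInv, orbitAngle_coneMap hm hw hU]
  refine ⟨⟨by rwa [hw'], ?_⟩, ?_⟩
  · rw [h2, add_sub_cancel_left, abs_lt]
    exact ⟨neg_pi_lt_arg _, lt_of_le_of_ne (arg_le_pi _) (mem_slitPlane_iff_arg.1 hs).1⟩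
  · rw [coneChart, hw', h2]
    congr 1
    have hn : ‖U * exp (-t * I)‖ = 1 := by
      have := norm_exp_ofReal_mul_I (-t)
      push_cast at this
      rw [norm_mul, hU, this, one_mul]
    have h := norm_mul_exp_arg_mul_I (U * exp (-t * I))
    rw [hn, ofReal_one, one_mul] at h
    push_cast
    rw [add_mul, Complex.exp_add, h, mul_left_comm, ← Complex.exp_add]
    simp

lemma mem_chartDomain_self {y : EuclideanSpace ℝ (Fin 3)} (hy : planeCoord y ≠ 0) :
    y ∈ chartDomain (y 2) := ⟨hy, by simp [Real.pi_pos]⟩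

lemma exists_coneChart_eq {m : ℕ} {z : C3} (hz : z ∈ torusCone m \ {0}) :
    ∃ y, planeCoord y ≠ 0 ∧ coneChart m y = z := by
  obtain ⟨w, U, hw, hU, rfl⟩ := mem_torusCone_diff.1 hz
  have hw' : planeCoord !₂[w.re, w.im, arg U] = w := Complex.ext (by simp) (by simp)
  refine ⟨!₂[w.re, w.im, arg U], by rwa [hw'], ?_⟩
  rw [coneChart, hw']
  congr 1
  simpa [hU] using norm_mul_exp_arg_mul_I U

/-! ### Differentials of the charts and the calibration condition. -/

/-- The derivative of the height function `coneHeight m` in real coordinates. -/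
def heightDeriv (m : ℕ) (y v : EuclideanSpace ℝ (Fin 3)) : ℝ :=
  ((m + 1) * y 0 * v 0 + m * y 1 * v 1) / ((2 * m + 1) * coneHeight m (planeCoord y))

/-- Each coordinate is a constant times a phase times a real function, so the phase factors out: the
real part of the bracket differentiates the real function, the imaginary part is weight times
function times `v 2`. -/
lemma fderiv_coneChart {m : ℕ} (hm : 0 < m) {y : EuclideanSpace ℝ (Fin 3)}
    (hy : planeCoord y ≠ 0) (v : EuclideanSpace ℝ (Fin 3)) :
    fderiv ℝ (coneChart m) y v =
      !₂[exp (y 2 * I) ^ (m + 1) * (v 0 + (m + 1) * y 0 * v 2 * I),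
        exp (y 2 * I) ^ m * (v 1 + m * y 1 * v 2 * I),
        I * conj (exp (y 2 * I)) ^ (2 * m + 1) * (heightDeriv m y v
          - (2 * m + 1) * coneHeight m (planeCoord y) * v 2 * I)] := by
  have hd : HasFDerivAt (coneChart m) (fderiv ℝ (coneChart m) y) y :=
    ((contDiffAt_coneChart hm hy).differentiableAt (by simp)).hasFDerivAt
  have hline : HasDerivAt (fun τ : ℝ => coneChart m (y + τ • v))
      (fderiv ℝ (coneChart m) y v) 0 := by
    have hl : HasDerivAt (fun τ : ℝ => y + τ • v) v 0 := by
      simpa using ((hasDerivAt_id (0 : ℝ)).smul_const v).const_add y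
    exact HasFDerivAt.comp_hasDerivAt (f := fun τ : ℝ => y + τ • v) 0 (by simpa using hd) hl
  have hc (i : Fin 3) : HasDerivAt (fun τ : ℝ => coneChart m (y + τ • v) i)
      (fderiv ℝ (coneChart m) y v i) 0 :=
    hline.apply_C3 i
  have hx (i : Fin 3) : HasDerivAt (fun τ : ℝ => y i + τ * v i) (v i) 0 := by
    simpa using ((hasDerivAt_id (0 : ℝ)).mul_const (v i)).const_add (y i)
  have hE : HasDerivAt (fun τ : ℝ => exp ((y 2 + τ * v 2 : ℝ) * I))
      (exp (y 2 * I) * (v 2 * I)) 0 := by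
    simpa using ((hx 2).ofReal_comp.mul_const I).cexp
  have hEc : HasDerivAt (fun τ : ℝ => conj (exp ((y 2 + τ * v 2 : ℝ) * I)))
      (conj (exp (y 2 * I) * (v 2 * I))) 0 := hE.star
  have hH : HasDerivAt (fun τ : ℝ => √(((m + 1) * (y 0 + τ * v 0) ^ 2
      + m * (y 1 + τ * v 1) ^ 2) / (2 * m + 1))) (heightDeriv m y v) 0 := by
    have hpos := coneHeight_arg_pos hm hy
    have hsq := (((((hx 0).pow 2).const_mul ((m : ℝ) + 1)).add
      (((hx 1).pow 2).const_mul (m : ℝ))).div_const (2 * m + 1)).sqrt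
        (by simpa using hpos.ne')
    refine hsq.congr_deriv ?_
    have hh := (coneHeight_pos hm hy).ne'
    rw [heightDeriv]
    simp only [coneHeight, planeCoord_re, planeCoord_im] at hh ⊢
    simp only [Pi.add_apply, Pi.pow_apply, zero_mul, add_zero]
    field_simp
    ring
  ext i
  refine (hc i).unique ?_
  fin_cases i
  · refine (((hE.pow (m + 1)).mul (hx 0).ofReal_comp).congr_of_eventuallyEq ?_).congr_deriv ?_
    · exact .of_forall fun τ => by simp [coneChart]
    · simp; ring
  · refine (((hE.pow m).mul (hx 1).ofReal_comp).congr_of_eventuallyEq ?_).congr_deriv ?_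
    · exact .of_forall fun τ => by simp [coneChart]
    -- The power rule produces the exponent `m - 1`; writing `m = n + 1` removes the truncated
    -- subtraction.
    · obtain ⟨n, rfl⟩ : ∃ n, m = n + 1 := ⟨m - 1, by omega⟩
      simp; ring
  · refine ((((hEc.pow (2 * m + 1)).const_mul I).mul hH.ofReal_comp).congr_of_eventuallyEq
      ?_).congr_deriv ?_
    · exact .of_forall fun τ => by simp [coneChart, coneHeight]
    · simp [coneHeight]; ring

lemma fderiv_coneChart_injective {m : ℕ} (hm : 0 < m) {y : EuclideanSpace ℝ (Fin 3)}
    (hy : planeCoord y ≠ 0) : Function.Injective (fderiv ℝ (coneChart m) y) := by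
  rw [injective_iff_map_eq_zero]
  intro v hv
  rw [fderiv_coneChart hm hy] at hv
  have hm' : (m : ℝ) ≠ 0 := by exact_mod_cast hm.ne'
  have h0 := congrArg (fun z : C3 => z 0) hv
  have h1 := congrArg (fun z : C3 => z 1) hv
  simp only [Matrix.cons_val, PiLp.zero_apply, mul_eq_zero, pow_eq_zero_iff', exp_ne_zero,
    false_and, false_or] at h0 h1
  have h0r : v 0 = 0 := by simpa using congrArg re h0
  have h1r : v 1 = 0 := by simpa using congrArg im (congrArg (fun z => z * I) h1)
  have h0i : (m + 1) * y 0 * v 2 = 0 := by simpa using congrArg im h0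
  have h1i : m * y 1 * v 2 = 0 := by simpa using congrArg im h1
  have h2 : v 2 = 0 := by
    by_contra h2
    apply hy
    -- If `v 2 ≠ 0`, the imaginary parts force both plane coordinates to vanish, contradicting `hy`.
    have hm1 : (m : ℝ) + 1 ≠ 0 := by positivity
    exact Complex.ext (by simpa [h2, hm1] using h0i) (by simpa [h2, hm'] using h1i)
  ext i
  fin_cases i
  exacts [h0r, h1r, h2]

lemma isLocalParam_coneChart {m : ℕ} (hm : 0 < m) (t : ℝ) :
    IsLocalParam (torusCone m \ {0}) (chartDomain t) (coneChart m) where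
  isOpen_domain := isOpen_chartDomain t
  smooth := fun _ hy => (contDiffAt_coneChart hm hy.1).contDiffWithinAt
  immersion := fun _ hy => fderiv_coneChart_injective hm hy.1
  embedding := by
    -- A continuous map with a continuous left inverse on `chartTarget t` is an embedding.
    let f : chartDomain t → chartTarget t := fun y =>
      ⟨coneChart m y, coneChart_mem_chartTarget hm y.2⟩
    let g : chartTarget t → EuclideanSpace ℝ (Fin 3) := fun z => chartInv m t z
    have hf : Continuous f := by
      refine Continuous.subtype_mk (continuous_iff_continuousAt.2 fun y => ?_) _
      exact (contDiffAt_coneChart hm y.2.1).continuousAt.comp continuous_subtype_val.continuousAt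
    have hg : Continuous g := continuous_iff_continuousAt.2 fun z =>
      (continuousAt_chartInv m z.2).comp continuous_subtype_val.continuousAt
    have hgf : g ∘ f = Subtype.val := funext fun y => chartInv_coneChart hm y.2
    exact IsEmbedding.subtypeVal.comp
      (IsEmbedding.of_comp hf hg (by rw [hgf]; exact IsEmbedding.subtypeVal))
  open_image := by
    refine ⟨chartTarget t, isOpen_chartTarget t, Subset.antisymm ?_ ?_⟩
    · rintro _ ⟨y, hy, rfl⟩
      exact ⟨coneChart_mem_torusCone m hy.1, coneChart_mem_chartTarget hm hy⟩
    · rintro z ⟨hz, hzt⟩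
      obtain ⟨h1, h2⟩ := chartInv_mem_chartDomain hm hz hzt
      exact ⟨_, h1, h2⟩

/-- The orbit direction is Hermitian-orthogonal to the other two fields exactly by the
differentiated cone equation (`haH`, `hbH`). In the determinant the phases multiply to 1, and each
term contains one `I` from the last coordinate and one from the rotation. -/
lemma reOmega_coordVec_coneChart {m : ℕ} (hm : 0 < m) {y : EuclideanSpace ℝ (Fin 3)}
    (hy : planeCoord y ≠ 0) :
    reOmega (coordVec (coneChart m) y) = vol3 (coordVec (coneChart m) y) := by
  set U := exp (y 2 * I) with hUdef
  have hU : ‖U‖ = 1 := norm_exp_ofReal_mul_I _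
  have hUU := conj_mul_self_of_norm hU
  set H := coneHeight m (planeCoord y) with hHdef
  have hH : 0 < H := coneHeight_pos hm hy
  -- `a` and `b` are the partial derivatives of the height.
  set a := (m + 1) * y 0 / ((2 * m + 1) * H) with ha
  set b := m * y 1 / ((2 * m + 1) * H) with hb
  have haH : a * ((2 * m + 1) * H) = (m + 1) * y 0 := by rw [ha]; field_simp
  have hbH : b * ((2 * m + 1) * H) = m * y 1 := by rw [hb]; field_simp
  have haH' : (a : ℂ) * ((2 * m + 1) * H) = (m + 1) * y 0 := by exact_mod_cast haH
  have hbH' : (b : ℂ) * ((2 * m + 1) * H) = m * y 1 := by exact_mod_cast hbH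
  have hv0 : coordVec (coneChart m) y 0 =
      !₂[U ^ (m + 1), 0, I * conj U ^ (2 * m + 1) * a] := by
    rw [coordVec, fderiv_coneChart hm hy]
    simp [heightDeriv, ← hUdef, ← hHdef, ha]
  have hv1 : coordVec (coneChart m) y 1 =
      !₂[0, U ^ m, I * conj U ^ (2 * m + 1) * b] := by
    rw [coordVec, fderiv_coneChart hm hy]
    simp [heightDeriv, ← hUdef, ← hHdef, hb]
  have hv2 : coordVec (coneChart m) y 2 =
      !₂[U ^ (m + 1) * ((m + 1) * y 0 * I), U ^ m * (m * y 1 * I),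
        I * conj U ^ (2 * m + 1) * (-((2 * m + 1) * H * I))] := by
    rw [coordVec, fderiv_coneChart hm hy]
    simp [heightDeriv, ← hUdef, ← hHdef]
  have hp (n : ℕ) : conj U ^ n * U ^ n = 1 := by rw [← mul_pow, hUU, one_pow]
  have hinner (x x' : C3) : inner ℂ x x' =
      conj (x 0) * x' 0 + conj (x 1) * x' 1 + conj (x 2) * x' 2 := by
    rw [PiLp.inner_apply, Fin.sum_univ_three]
    simp [mul_comm]
  have g00 : inner ℂ (coordVec (coneChart m) y 0) (coordVec (coneChart m) y 0) =
      ((1 + a ^ 2 : ℝ) : ℂ) := by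
    rw [hinner, hv0]
    simp
    linear_combination hp (m + 1) + a ^ 2 * hp (2 * m + 1)
      - a ^ 2 * (conj U ^ (2 * m + 1) * U ^ (2 * m + 1)) * I_sq
  have g01 : inner ℂ (coordVec (coneChart m) y 0) (coordVec (coneChart m) y 1) =
      ((a * b : ℝ) : ℂ) := by
    rw [hinner, hv0, hv1]
    simp
    linear_combination a * b * hp (2 * m + 1)
      - a * b * (conj U ^ (2 * m + 1) * U ^ (2 * m + 1)) * I_sq
  have g11 : inner ℂ (coordVec (coneChart m) y 1) (coordVec (coneChart m) y 1) =
      ((1 + b ^ 2 : ℝ) : ℂ) := by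
    rw [hinner, hv1]
    simp
    linear_combination hp m + b ^ 2 * hp (2 * m + 1)
      - b ^ 2 * (conj U ^ (2 * m + 1) * U ^ (2 * m + 1)) * I_sq
  have g02 : inner ℂ (coordVec (coneChart m) y 0) (coordVec (coneChart m) y 2) = 0 := by
    rw [hinner, hv0, hv2]
    simp
    linear_combination ((m + 1) * y 0 * I) * hp (m + 1)
      - a * ((2 * m + 1) * H * I) * hp (2 * m + 1) - I * haH'
      + a * ((2 * m + 1) * H * I) * (conj U ^ (2 * m + 1) * U ^ (2 * m + 1)) * I_sq
  have g12 : inner ℂ (coordVec (coneChart m) y 1) (coordVec (coneChart m) y 2) = 0 := by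
    rw [hinner, hv1, hv2]
    simp
    linear_combination (m * y 1 * I) * hp m
      - b * ((2 * m + 1) * H * I) * hp (2 * m + 1) - I * hbH'
      + b * ((2 * m + 1) * H * I) * (conj U ^ (2 * m + 1) * U ^ (2 * m + 1)) * I_sq
  have hsymm (i j : Fin 3)
      (h : (inner ℂ (coordVec (coneChart m) y i) (coordVec (coneChart m) y j)).im = 0) :
      (inner ℂ (coordVec (coneChart m) y j) (coordVec (coneChart m) y i)).im = 0 := by
    rw [← inner_conj_symm, conj_im, h, neg_zero]
  have g01' := (congrArg im g01).trans (ofReal_im _)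
  have g02' := congrArg im g02
  have g12' := congrArg im g12
  refine reOmega_eq_vol3 (r := (2 * m + 1) * H + m * y 1 * b + (m + 1) * y 0 * a) ?_ ?_ ?_
  -- By the cone equation the determinant is (2m + 1) H (1 + a² + b²).
  · rw [← haH, ← hbH]
    have : 0 ≤ b * ((2 * m + 1) * H) * b := by
      rw [mul_right_comm]; exact mul_nonneg (mul_self_nonneg b) (by positivity)
    have : 0 ≤ a * ((2 * m + 1) * H) * a := by
      rw [mul_right_comm]; exact mul_nonneg (mul_self_nonneg a) (by positivity)
    positivity
  · intro i j
    fin_cases i <;> fin_cases j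
    exacts [(congrArg im g00).trans (ofReal_im _), g01', g02', hsymm _ _ g01',
      (congrArg im g11).trans (ofReal_im _), g12', hsymm _ _ g02', hsymm _ _ g12',
      inner_self_im (𝕜 := ℂ) (coordVec (coneChart m) y 2)]
  · rw [Matrix.det_fin_three]
    simp only [Matrix.of_apply, hv0, hv1, hv2, Matrix.cons_val]
    have hprod : U ^ (m + 1) * U ^ m * conj U ^ (2 * m + 1) = 1 := by
      rw [← hp (2 * m + 1)]; ring
    push_cast
    linear_combination ((2 * m + 1) * H + m * y 1 * b + (m + 1) * y 0 * a) * hprod -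
      ((2 * m + 1) * H + m * y 1 * b + (m + 1) * y 0 * a) *
      (U ^ (m + 1) * U ^ m * conj U ^ (2 * m + 1)) * I_sq

lemma isSpecialLagrangian_torusCone {m : ℕ} (hm : 0 < m) :
    IsSpecialLagrangian (torusCone m \ {0}) := by
  intro p hp
  obtain ⟨y, hy, rfl⟩ := exists_coneChart_eq hp
  exact ⟨_, _, isLocalParam_coneChart hm (y 2), ⟨y, mem_chartDomain_self hy, rfl⟩,
    fun x hx => reOmega_coordVec_coneChart hm hx.1⟩

/-! ### The link -/

lemma smul_mem_torusCone {m : ℕ} {z : C3} (hz : z ∈ torusCone m) {r : ℝ} (hr : 0 ≤ r) :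
    r • z ∈ torusCone m := by
  obtain ⟨w, U, hU, rfl⟩ := hz
  exact ⟨r * w, U, hU, (coneMap_smul m hr w U).symm⟩

/-- The radial projection to the sphere of `coneMap m`. -/
def linkMap (m : ℕ) (p : ℂ × ℂ) : C3 := ‖coneMap m p.1 p.2‖⁻¹ • coneMap m p.1 p.2

/-- The map `linkMap m` on the torus. -/
def linkTorus (m : ℕ) (x : Circle × Circle) : C3 := linkMap m (x.1, x.2)

lemma linkTorus_eq (m : ℕ) (x : Circle × Circle) :
    linkTorus m x = coneMap m ((‖coneMap m x.1 x.2‖⁻¹ : ℝ) * x.1) x.2 :=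
  (coneMap_smul m (inv_nonneg.2 (norm_nonneg _)) _ _).symm

lemma inv_norm_coneMap_pos (m : ℕ) (x : Circle × Circle) : 0 < ‖coneMap m x.1 x.2‖⁻¹ :=
  inv_pos.2 (norm_pos_iff.2 (coneMap_ne_zero m x.1.coe_ne_zero x.2.norm_coe))

lemma inv_norm_mul_ne_zero (m : ℕ) (x : Circle × Circle) :
    ((‖coneMap m x.1 x.2‖⁻¹ : ℝ) : ℂ) * x.1 ≠ 0 :=
  mul_ne_zero (ofReal_ne_zero.2 (inv_norm_coneMap_pos m x).ne') x.1.coe_ne_zero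

lemma range_linkTorus (m : ℕ) : range (linkTorus m) = link (torusCone m) := by
  apply Subset.antisymm
  · rintro _ ⟨x, rfl⟩
    refine ⟨smul_mem_torusCone ⟨_, _, x.2.norm_coe, rfl⟩ (inv_norm_coneMap_pos m x).le, ?_⟩
    rw [mem_sphere_zero_iff_norm]
    exact norm_smul_inv_norm (𝕜 := ℝ) (coneMap_ne_zero m x.1.coe_ne_zero x.2.norm_coe)
  · rintro _ ⟨⟨w, U, hU, rfl⟩, h1⟩
    rw [mem_sphere_zero_iff_norm] at h1
    have hw : w ≠ 0 := by
      rintro rfl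
      simp [coneMap_zero] at h1
    have hw' : ‖w‖ ≠ 0 := norm_ne_zero_iff.2 hw
    have hV : ‖w / ‖w‖‖ = 1 := by simp [hw]
    refine ⟨(⟨w / ‖w‖, mem_sphere_zero_iff_norm.2 hV⟩, ⟨U, mem_sphere_zero_iff_norm.2 hU⟩), ?_⟩
    have e : coneMap m (w / ‖w‖) U = ‖w‖⁻¹ • coneMap m w U := by
      rw [← coneMap_smul m (inv_nonneg.2 (norm_nonneg _))]
      congr 1
      push_cast
      rw [div_eq_inv_mul]
    change ‖coneMap m (w / ‖w‖) U‖⁻¹ • coneMap m (w / ‖w‖) U = _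
    rw [e, norm_smul, h1, norm_inv, norm_norm, mul_one, inv_inv, smul_smul,
      mul_inv_cancel₀ hw', one_smul]

lemma isSpecialLagrangianCone_torusCone {m : ℕ} (hm : 0 < m) :
    IsSpecialLagrangianCone (torusCone m) := by
  refine ⟨Subset.antisymm ?_ ?_, isSpecialLagrangian_torusCone hm⟩
  · intro z hz
    by_cases h0 : z = 0
    · refine ⟨0, le_rfl, linkTorus m (1, 1), ?_, by simp [h0]⟩
      rw [← range_linkTorus]
      exact mem_range_self _
    · refine ⟨‖z‖, norm_nonneg _, ‖z‖⁻¹ • z,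
        ⟨smul_mem_torusCone hz (inv_nonneg.2 (norm_nonneg _)), ?_⟩, ?_⟩
      · rw [mem_sphere_zero_iff_norm]
        exact norm_smul_inv_norm (𝕜 := ℝ) h0
      · rw [smul_smul, mul_inv_cancel₀ (norm_ne_zero_iff.2 h0), one_smul]
  · rintro _ ⟨r, hr, x, hx, rfl⟩
    exact smul_mem_torusCone hx.1 hr

/-- A left inverse of `linkTorus m`, smooth near its image. -/
def linkInv (m : ℕ) (z : C3) : ℂ × ℂ := (orbitBase m z / ‖orbitBase m z‖, orbitAngle z)

lemma linkInv_linkTorus {m : ℕ} (hm : 0 < m) (x : Circle × Circle) :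
    linkInv m (linkTorus m x) = (↑x.1, ↑x.2) := by
  have h0 := inv_norm_mul_ne_zero m x
  have hr := inv_norm_coneMap_pos m x
  rw [linkInv, linkTorus_eq, orbitBase_coneMap hm h0 x.2.norm_coe,
    orbitAngle_coneMap hm h0 x.2.norm_coe]
  refine Prod.ext ?_ rfl
  simp only [norm_mul, Circle.norm_coe, norm_real, Real.norm_of_nonneg hr.le, mul_one]
  exact mul_div_cancel_left₀ _ (ofReal_ne_zero.2 hr.ne')

lemma contDiffAt_linkMap {m : ℕ} (hm : 0 < m) (x : Circle × Circle) :
    ContDiffAt ℝ ∞ (linkMap m) ((x.1, x.2) : ℂ × ℂ) := by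
  have h := contDiffAt_coneMap hm (p := ((x.1, x.2) : ℂ × ℂ)) x.1.coe_ne_zero
  have h0 := coneMap_ne_zero m x.1.coe_ne_zero x.2.norm_coe
  exact ((h.norm ℝ h0).inv (norm_ne_zero_iff.2 h0)).smul h

lemma contDiffAt_linkInv {m : ℕ} (hm : 0 < m) (x : Circle × Circle) :
    ContDiffAt ℝ ∞ (linkInv m) (linkTorus m x) := by
  have h0 := inv_norm_mul_ne_zero m x
  have hreg : linkTorus m x ∈ regularSet := by
    rw [linkTorus_eq]
    exact coneMap_mem_regularSet hm h0 x.2.norm_coe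
  have hb0 : orbitBase m (linkTorus m x) ≠ 0 := by
    rwa [linkTorus_eq, orbitBase_coneMap hm h0 x.2.norm_coe]
  have hb := contDiffAt_orbitBase m hreg
  exact (hb.mul ((contDiff_ofReal.contDiffAt.comp _ (hb.norm ℝ hb0)).inv
    (by simpa using hb0))).prodMk (contDiffAt_orbitAngle hreg)

lemma contMDiff_circle_coe : ContMDiff (𝓡 1) 𝓘(ℝ, ℂ) ∞ (fun x : Circle => (x : ℂ)) :=
  haveI := finrank_real_complex_fact'
  contMDiff_coe_sphere (E := ℂ) (n := 1)

lemma mfderiv_circle_coe_injective (x : Circle) :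
    Function.Injective (mfderiv (𝓡 1) 𝓘(ℝ, ℂ) (fun x : Circle => (x : ℂ)) x) :=
  haveI := finrank_real_complex_fact'
  injective_mvfderiv_subtypeVal_sphere (E := ℂ) (n := 1) x

lemma contMDiff_torus_coe :
    ContMDiff ((𝓡 1).prod (𝓡 1)) 𝓘(ℝ, ℂ × ℂ) ∞
      (fun x : Circle × Circle => ((x.1, x.2) : ℂ × ℂ)) :=
  (contMDiff_circle_coe.comp contMDiff_fst).prodMk_space (contMDiff_circle_coe.comp contMDiff_snd)

lemma mfderiv_torus_coe_injective (x : Circle × Circle) :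
    Function.Injective (mfderiv ((𝓡 1).prod (𝓡 1)) 𝓘(ℝ, ℂ × ℂ)
      (fun x : Circle × Circle => ((x.1, x.2) : ℂ × ℂ)) x) := by
  have h (y : Circle) : MDifferentiableAt (𝓡 1) 𝓘(ℝ, ℂ) (fun x : Circle => (x : ℂ)) y :=
    contMDiff_circle_coe.mdifferentiableAt (by simp)
  have e := mfderiv_prodMap (p := x) (h x.1) (h x.2)
  -- The self-model of ℂ × ℂ is rewritten as a product model, so that the differential of a product
  -- map applies.
  rw [modelWithCornersSelf_prod, ← chartedSpaceSelf_prod]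
  change Function.Injective (mfderiv ((𝓡 1).prod (𝓡 1)) (𝓘(ℝ, ℂ).prod 𝓘(ℝ, ℂ))
    (Prod.map (fun x : Circle => (x : ℂ)) (fun x : Circle => (x : ℂ))) x)
  rw [e]
  exact (mfderiv_circle_coe_injective x.1).prodMap (mfderiv_circle_coe_injective x.2)

/-- `linkInv m` turns `linkTorus m` into the inclusion of the torus in ℂ × ℂ, so the chain rule
gives the immersion; injectivity and compactness give the embedding. -/
lemma isEmbeddedTorus_link {m : ℕ} (hm : 0 < m) : IsEmbeddedTorus (link (torusCone m)) := by
  have hsmooth : ContMDiff ((𝓡 1).prod (𝓡 1)) 𝓘(ℝ, C3) ∞ (linkTorus m) := fun x =>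
    (contDiffAt_linkMap hm x).contMDiffAt.comp x (contMDiff_torus_coe x)
  have hinv : linkInv m ∘ linkTorus m = fun x => ((x.1, x.2) : ℂ × ℂ) :=
    funext fun x => linkInv_linkTorus hm x
  refine ⟨linkTorus m, hsmooth, fun x => ?_, ?_, range_linkTorus m⟩
  · have hd := mfderiv_comp x
      ((contDiffAt_linkInv hm x).contMDiffAt.mdifferentiableAt (by simp))
      (hsmooth.mdifferentiableAt (by simp) (x := x))
    have hinj := mfderiv_torus_coe_injective x
    rw [← hinv, hd] at hinj
    exact Function.Injective.of_comp hinj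
  · refine (hsmooth.continuous.isClosedEmbedding fun x y hxy => ?_).isEmbedding
    have h := congrArg (linkInv m) hxy
    rw [linkInv_linkTorus hm, linkInv_linkTorus hm, Prod.ext_iff] at h
    exact Prod.ext (Circle.ext h.1) (Circle.ext h.2)

/-! ### The circle action -/

/-- The diagonal matrix with entries `ζ ^ (m + 1)`, `ζ ^ m`, `ζ ^ (-(2m + 1))`. -/
def weightMatrix (m : ℕ) (ζ : ℂ) : Matrix (Fin 3) (Fin 3) ℂ :=
  Matrix.diagonal ![ζ ^ (m + 1), ζ ^ m, conj ζ ^ (2 * m + 1)]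

lemma weightMatrix_mul (m : ℕ) (ζ η : ℂ) :
    weightMatrix m (ζ * η) = weightMatrix m ζ * weightMatrix m η := by
  rw [weightMatrix, weightMatrix, weightMatrix, Matrix.diagonal_mul_diagonal]
  congr 1
  ext i
  fin_cases i <;> simp [mul_pow]

lemma weightMatrix_one (m : ℕ) : weightMatrix m 1 = 1 := by
  rw [weightMatrix, ← Matrix.diagonal_one]
  congr 1
  ext i
  fin_cases i <;> simp

lemma weightMatrix_mem (m : ℕ) {ζ : ℂ} (hζ : ‖ζ‖ = 1) :
    weightMatrix m ζ ∈ Matrix.specialUnitaryGroup (Fin 3) ℂ := by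
  have hζζ := conj_mul_self_of_norm hζ
  rw [Matrix.mem_specialUnitaryGroup_iff]
  constructor
  · have hstar : star (weightMatrix m ζ) = weightMatrix m (conj ζ) := by
      rw [Matrix.star_eq_conjTranspose, weightMatrix, Matrix.diagonal_conjTranspose, weightMatrix]
      congr 1
      ext i
      fin_cases i <;> simp
    rw [Matrix.mem_unitaryGroup_iff', hstar, ← weightMatrix_mul, hζζ, weightMatrix_one]
  · rw [weightMatrix, Matrix.det_diagonal, Fin.prod_univ_three]
    simp only [Matrix.cons_val]
    calc _ = (conj ζ * ζ) ^ (2 * m + 1) := by ring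
      _ = 1 := by rw [hζζ, one_pow]

/-- The circle subgroup of `SU(3)` with weights `(m + 1, m, -(2m + 1))`. -/
def weightHom (m : ℕ) : Circle →* Matrix.specialUnitaryGroup (Fin 3) ℂ where
  toFun ζ := ⟨weightMatrix m ζ, weightMatrix_mem m ζ.norm_coe⟩
  map_one' := Subtype.ext (by simp [weightMatrix_one])
  map_mul' ζ η := Subtype.ext (by simp [weightMatrix_mul])

lemma toEuclideanLin_weightMatrix (m : ℕ) (ζ w U : ℂ) :
    Matrix.toEuclideanLin (weightMatrix m ζ) (coneMap m w U) = coneMap m w (ζ * U) := by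
  rw [coneMap_mul]
  ext i
  fin_cases i <;> simp [weightMatrix, Matrix.toLpLin_apply, Matrix.mulVec_diagonal]

lemma isCircleInvariant_link (m : ℕ) : IsCircleInvariant (link (torusCone m)) := by
  have hcont : Continuous fun ζ : Circle => weightMatrix m ζ := by
    refine Continuous.matrix_diagonal (continuous_pi fun i => ?_)
    fin_cases i <;> simp <;> fun_prop
  have hmaps (ζ : Circle) (x : C3) (hx : x ∈ link (torusCone m)) :
      Matrix.toEuclideanLin (weightMatrix m ζ) x ∈ link (torusCone m) := by
    obtain ⟨⟨w, U, hU, rfl⟩, h1⟩ := hx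
    have hζU : ‖(ζ : ℂ) * U‖ = 1 := by rw [norm_mul, hU, ζ.norm_coe, one_mul]
    rw [toEuclideanLin_weightMatrix]
    refine ⟨⟨w, _, hζU, rfl⟩, ?_⟩
    rw [mem_sphere_zero_iff_norm] at h1 ⊢
    rw [← sq_eq_sq₀ (norm_nonneg _) zero_le_one, norm_sq_coneMap m w hζU,
      ← norm_sq_coneMap m w hU, h1]
  refine ⟨weightHom m, hcont.subtype_mk _, fun ζ η h => ?_, fun ζ => ?_⟩
  -- Faithfulness: the weights m + 1 and m are consecutive, so the quotient of the first two entries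
  -- is ζ.
  · have h' : weightMatrix m ζ = weightMatrix m η := congrArg Subtype.val h
    have h0 := congrFun (congrFun h' 0) 0
    have h1 := congrFun (congrFun h' 1) 1
    simp only [weightMatrix, Matrix.diagonal_apply_eq, Matrix.cons_val] at h0 h1
    rw [pow_succ, pow_succ, h1] at h0
    exact Circle.ext (mul_left_cancel₀ (pow_ne_zero m η.coe_ne_zero) h0)
  · apply Subset.antisymm
    · rintro _ ⟨x, hx, rfl⟩
      exact hmaps ζ x hx
    · intro x hx
      refine ⟨_, hmaps ζ⁻¹ x hx, ?_⟩
      obtain ⟨⟨w, U, hU, rfl⟩, -⟩ := hx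
      change Matrix.toEuclideanLin (weightMatrix m ζ) _ = _
      rw [toEuclideanLin_weightMatrix, toEuclideanLin_weightMatrix, ← mul_assoc,
        ← Circle.coe_mul, mul_inv_cancel, Circle.coe_one, one_mul]

/-! ### Isometries between the cones -/

lemma hasDerivAt_line {E : Type*} [NormedAddCommGroup E] [NormedSpace ℝ E] (a b : E) (r : ℝ) :
    HasDerivAt (fun s : ℝ => a + s • b) b r := by
  simpa using (hasDerivAt_id r).smul_const b

lemma contDiffAt_comp_coneChart {m : ℕ} (hm : 0 < m) {f : C3 → C3} {N : Set C3}
    (hf : IsMetricPreserving f (torusCone m \ {0}) N) {y : EuclideanSpace ℝ (Fin 3)}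
    (hy : planeCoord y ≠ 0) : ContDiffAt ℝ ∞ (f ∘ coneChart m) y :=
  (hf.2 _ _ (isLocalParam_coneChart hm (y 2))).1.contDiffAt
    ((isOpen_chartDomain _).mem_nhds (mem_chartDomain_self hy))

lemma norm_fderiv_comp_coneChart {m : ℕ} (hm : 0 < m) {f : C3 → C3} {N : Set C3}
    (hf : IsMetricPreserving f (torusCone m \ {0}) N) {y : EuclideanSpace ℝ (Fin 3)}
    (hy : planeCoord y ≠ 0) (v : EuclideanSpace ℝ (Fin 3)) :
    ‖fderiv ℝ (f ∘ coneChart m) y v‖ = ‖fderiv ℝ (coneChart m) y v‖ :=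
  (hf.2 _ _ (isLocalParam_coneChart hm (y 2))).2 y (mem_chartDomain_self hy) v

/-- An isometry preserves the length of a curve that is given in coordinates. -/
lemma hasDerivAt_comp_coneChart {m : ℕ} (hm : 0 < m) {f : C3 → C3} {N : Set C3}
    (hf : IsMetricPreserving f (torusCone m \ {0}) N) {c : ℝ → EuclideanSpace ℝ (Fin 3)}
    {c' : EuclideanSpace ℝ (Fin 3)} {τ : ℝ} (hc : HasDerivAt c c' τ)
    (hy : planeCoord (c τ) ≠ 0) {z' : C3} (hz : HasDerivAt (fun s => coneChart m (c s)) z' τ) :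
    ∃ x' : C3, HasDerivAt (fun s => f (coneChart m (c s))) x' τ ∧ ‖x'‖ = ‖z'‖ := by
  have h1 := ((contDiffAt_comp_coneChart hm hf hy).differentiableAt
    (by simp)).hasFDerivAt.comp_hasDerivAt τ hc
  have h2 := ((contDiffAt_coneChart hm hy).differentiableAt
    (by simp)).hasFDerivAt.comp_hasDerivAt τ hc
  refine ⟨_, h1, ?_⟩
  rw [norm_fderiv_comp_coneChart hm hf hy, hz.unique h2]

/-- The map is controlled only in charts, so near `p` it is factored through `chartInv`; the
factorization agrees with `f` on the cone only. -/
lemma continuousWithinAt_of_isMetricPreserving {m : ℕ} (hm : 0 < m) {f : C3 → C3} {N : Set C3}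
    (hf : IsMetricPreserving f (torusCone m \ {0}) N) {p : C3} (hp : p ∈ torusCone m \ {0}) :
    ContinuousWithinAt f (torusCone m \ {0}) p := by
  obtain ⟨y, hy, rfl⟩ := exists_coneChart_eq hp
  have hyd := mem_chartDomain_self hy
  have ht := coneChart_mem_chartTarget hm hyd
  have hc : ContinuousAt ((f ∘ coneChart m) ∘ chartInv m (y 2)) (coneChart m y) := by
    refine ContinuousAt.comp ?_ (continuousAt_chartInv m ht)
    rw [chartInv_coneChart hm hyd]
    exact (contDiffAt_comp_coneChart hm hf hy).continuousAt
  refine hc.continuousWithinAt.congr_of_eventuallyEq ?_ ?_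
  · filter_upwards [self_mem_nhdsWithin,
      mem_nhdsWithin_of_mem_nhds ((isOpen_chartTarget (y 2)).mem_nhds ht)] with z hz hzt
    simp [(chartInv_mem_chartDomain hm hz hzt).2]
  · simp [chartInv_coneChart hm hyd]

/-- The closed ball contains `w = 0`, so limits of bounded sequences stay in the cone but may be the
vertex. -/
lemma isCompact_torusCone_piece (m : ℕ) (R : ℝ) :
    IsCompact ((fun p : ℂ × ℂ => coneMap m p.1 p.2) ''
      (Metric.closedBall 0 R ×ˢ Metric.sphere 0 1)) :=
  ((isCompact_closedBall 0 R).prod (isCompact_sphere 0 1)).image (continuous_coneMap m)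

/-- An isometry does not increase the distance to the vertex: the image of the segment from a
point to the vertex has finite length and can only converge to the vertex. -/
lemma norm_map_le {j k : ℕ} (hj : 0 < j) (hk : 0 < k) {f g : C3 → C3}
    (hf : IsMetricPreserving f (torusCone j \ {0}) (torusCone k \ {0}))
    (hg : IsMetricPreserving g (torusCone k \ {0}) (torusCone j \ {0}))
    (hgf : LeftInvOn g f (torusCone j \ {0})) {p : C3} (hp : p ∈ torusCone j \ {0}) :
    ‖f p‖ ≤ ‖p‖ := by
  obtain ⟨y, hy, rfl⟩ := exists_coneChart_eq hp
  set p := coneChart j y with hpdef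
  -- The ray through `p` in coordinates: the plane part scales and the angle `y 2` stays fixed.
  let c : ℝ → EuclideanSpace ℝ (Fin 3) := fun r => !₂[0, 0, y 2] + r • !₂[y 0, y 1, 0]
  have hc (r : ℝ) : HasDerivAt c !₂[y 0, y 1, 0] r := 
    hasDerivAt_line _ _ r
  have hpc (r : ℝ) : planeCoord (c r) = r * planeCoord y := by
    apply Complex.ext <;> simp [c]
  have hpc0 {r : ℝ} (hr : 0 < r) : planeCoord (c r) ≠ 0 := by
    rw [hpc]
    exact mul_ne_zero (ofReal_ne_zero.2 hr.ne') hy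
  have hcr {r : ℝ} (hr : 0 < r) : coneChart j (c r) = r • p := by
    rw [coneChart, hpc, coneMap_smul j hr.le, hpdef, coneChart]
    simp [c]
  have hmem {r : ℝ} (hr : 0 < r) : r • p ∈ torusCone j \ {0} := by
    rw [← hcr hr]
    exact coneChart_mem_torusCone j (hpc0 hr)
  let h : ℝ → C3 := fun r => f (coneChart j (c r))
  have hh {r : ℝ} (hr : 0 < r) : h r = f (r • p) := by simp only [h, hcr hr]
  have hderiv (r : ℝ) (hr : 0 < r) : ∃ x', HasDerivAt h x' r ∧ ‖x'‖ = ‖p‖ := by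
    refine hasDerivAt_comp_coneChart hj hf (hc r) (hpc0 hr) (z' := p) ?_
    have : HasDerivAt (fun r : ℝ => r • p) p r := by
      simpa using (hasDerivAt_id r).smul_const p
    refine this.congr_of_eventuallyEq ?_
    filter_upwards [lt_mem_nhds hr] with s hs using hcr hs
  choose! x' hx' using hderiv
  have hlip {r : ℝ} (hr : 0 < r) : ‖h 1 - h r‖ ≤ ‖p‖ * ‖1 - r‖ :=
    (convex_Ioi (0 : ℝ)).norm_image_sub_le_of_norm_hasDerivWithin_le
      (fun s hs => (hx' s hs).1.hasDerivWithinAt) (fun s hs => (hx' s hs).2.le) (mem_Ioi.2 hr)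
      (mem_Ioi.2 one_pos)
  let ε : ℕ → ℝ := fun n => 1 / ((n : ℝ) + 1)
  have hε0 (n : ℕ) : 0 < ε n := Nat.one_div_pos_of_nat
  have hε1 (n : ℕ) : ‖1 - ε n‖ ≤ 1 := by
    have : ε n ≤ 1 := by
      rw [div_le_one (by positivity)]
      have : (0 : ℝ) ≤ n := n.cast_nonneg
      linarith
    rw [Real.norm_eq_abs, abs_le]
    constructor <;> linarith [hε0 n]
  have hεlim : Filter.Tendsto ε Filter.atTop (𝓝 0) := tendsto_one_div_add_atTop_nhds_zero_nat
  have hK (n : ℕ) : h (ε n) ∈ (fun p : ℂ × ℂ => coneMap k p.1 p.2) ''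
      (Metric.closedBall 0 (‖h 1‖ + ‖p‖) ×ˢ Metric.sphere 0 1) := by
    have hN := hf.1 (hmem (hε0 n))
    rw [← hh (hε0 n)] at hN
    obtain ⟨w, U, -, hU, hwU⟩ := mem_torusCone_diff.1 hN
    refine ⟨(w, U), ⟨?_, mem_sphere_zero_iff_norm.2 hU⟩, hwU.symm⟩
    rw [mem_closedBall_zero_iff]
    have e1 := norm_le_norm_coneMap k w hU
    rw [← hwU] at e1
    have e2 := hlip (hε0 n)
    have e3 : ‖p‖ * ‖1 - ε n‖ ≤ ‖p‖ := mul_le_of_le_one_right (norm_nonneg _) (hε1 n)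
    have e4 : ‖h (ε n)‖ ≤ ‖h 1‖ + ‖h 1 - h (ε n)‖ := norm_le_norm_add_norm_sub _ _
    exact e1.trans (e4.trans (by gcongr; exact e2.trans e3))
  obtain ⟨q, ⟨⟨w, U⟩, ⟨-, hU⟩, hq⟩, φ, hφ, hlim⟩ :=
    (isCompact_torusCone_piece k (‖h 1‖ + ‖p‖)).tendsto_subseq hK
  have hεφ : Filter.Tendsto (fun n => ε (φ n)) Filter.atTop (𝓝 0) :=
    hεlim.comp hφ.tendsto_atTop
  have hq0 : q = 0 := by
    -- Were the limit a regular point, continuity of `g` there would give `g q = lim ε • p = 0`, but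
    -- `g q` is not the vertex.
    by_contra hq0
    have hqN : q ∈ torusCone k \ {0} := ⟨⟨w, U, mem_sphere_zero_iff_norm.1 hU, hq.symm⟩, hq0⟩
    have t1 : Filter.Tendsto (fun n => g (h (ε (φ n)))) Filter.atTop (𝓝 (g q)) := by
      refine (continuousWithinAt_of_isMetricPreserving hk hg hqN).tendsto.comp
        (tendsto_nhdsWithin_iff.2 ⟨hlim, .of_forall fun n => ?_⟩)
      simp only [hh (hε0 _)]
      exact hf.1 (hmem (hε0 _))
    have t2 : Filter.Tendsto (fun n => g (h (ε (φ n)))) Filter.atTop (𝓝 0) := by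
      have : (fun n => g (h (ε (φ n)))) = fun n => ε (φ n) • p := by
        ext1 n
        rw [hh (hε0 _), hgf (hmem (hε0 _))]
      rw [this]
      simpa using hεφ.smul_const p
    exact (hg.1 hqN).2 (tendsto_nhds_unique t1 t2)
  have hfin := le_of_tendsto_of_tendsto ((tendsto_const_nhds (x := h 1)).sub hlim).norm
    ((tendsto_const_nhds (x := (1 : ℝ))).sub hεφ |>.norm.const_mul ‖p‖)
    (.of_forall fun n => hlip (hε0 _))
  simpa [hq0, hh one_pos] using hfin

/-- `norm_map_le` applies to the map and to its inverse. -/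
lemma norm_map_eq {j k : ℕ} (hj : 0 < j) (hk : 0 < k) {f g : C3 → C3}
    (hf : IsMetricPreserving f (torusCone j \ {0}) (torusCone k \ {0}))
    (hg : IsMetricPreserving g (torusCone k \ {0}) (torusCone j \ {0}))
    (hfg : InvOn g f (torusCone j \ {0}) (torusCone k \ {0})) {p : C3}
    (hp : p ∈ torusCone j \ {0}) : ‖f p‖ = ‖p‖ := by
  refine (norm_map_le hj hk hf hg hfg.1 hp).antisymm ?_
  have := norm_map_le hk hj hg hf hfg.2 (hf.1 hp)
  rwa [hfg.1 hp] at this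

/-! ### The rotation speed along curves in a cone -/

/-- If `a = x Uⁿ` with `x` real and `|U| = 1`, then the speed of `a` is at least `n |a|` times
the speed of `U`. -/
lemma mul_norm_deriv_le {a U : ℝ → ℂ} {x : ℝ → ℝ} {n : ℕ} {a' U' : ℂ} {τ : ℝ}
    (ha : HasDerivAt a a' τ) (hU : HasDerivAt U U' τ) (hU1 : ∀ s, ‖U s‖ = 1)
    (hax : ∀ s, a s = x s * U s ^ n) : n * ‖a τ‖ * ‖U'‖ ≤ ‖a'‖ := by
  have hUU (s : ℝ) : conj (U s) * U s = 1 := conj_mul_self_of_norm (hU1 s)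
  -- Differentiability of `x` is not assumed; it follows by recovering `x` from `a` and `U`.
  have hx_eq : x = fun s => (a s * conj (U s) ^ n).re := by
    ext s
    rw [hax, mul_assoc, ← mul_pow, mul_comm (U s), hUU, one_pow, mul_one, ofReal_re]
  have hUc : HasDerivAt (fun s => conj (U s)) (conj U') τ := hU.star
  obtain ⟨x', hx⟩ : ∃ x', HasDerivAt x x' τ := by
    rw [hx_eq]
    exact ⟨_, reCLM.hasFDerivAt.comp_hasDerivAt τ (ha.mul (hUc.pow n))⟩
  have himag : (conj (U τ) * U').re = 0 := by
    have h1 := hUc.mul hU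
    have h2 : HasDerivAt (fun s => conj (U s) * U s) 0 τ := by
      simp only [hUU]
      exact hasDerivAt_const _ _
    have h3 := congrArg re (h1.unique h2)
    simp at h3 ⊢
    linarith
  have ha' : a' = x' * U τ ^ n + x τ * (n * U τ ^ (n - 1) * U') :=
    ha.unique ((hx.ofReal_comp.mul (hU.pow n)).congr_of_eventuallyEq (.of_forall hax))
  -- Rotating back by the phase separates the change of `x` (real) from the rotation (imaginary, as
  -- `conj U * U'` is imaginary).
  have hrot : conj (U τ) ^ n * a' = x' + (n * x τ : ℝ) * (conj (U τ) * U') := by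
    have hp (l : ℕ) : conj (U τ) ^ l * U τ ^ l = 1 := by rw [← mul_pow, hUU, one_pow]
    rw [ha']
    cases n with
    | zero => simp
    | succ l =>
      rw [Nat.add_sub_cancel]
      push_cast
      linear_combination x' * hp (l + 1) + x τ * (l + 1) * U' * conj (U τ) * hp l
  have him : (conj (U τ) ^ n * a').im = n * x τ * (conj (U τ) * U').im := by
    rw [hrot, add_im, ofReal_im, im_ofReal_mul, zero_add]
  calc n * ‖a τ‖ * ‖U'‖ = n * |x τ| * ‖conj (U τ) * U'‖ := by
        rw [hax, norm_mul, norm_mul, norm_pow, hU1, norm_conj, hU1]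
        simp
    _ = |(conj (U τ) ^ n * a').im| := by
        rw [him, abs_mul, abs_mul, Nat.abs_cast,
          abs_im_eq_norm.2 himag]
    _ ≤ ‖conj (U τ) ^ n * a'‖ := abs_im_le_norm _
    _ = ‖a'‖ := by rw [norm_mul, norm_pow, norm_conj, hU1, one_pow, one_mul]

/-- Along a curve in `torusCone m` the angle moves at most `1 / (m r)` times as fast as the
point, where `r` is the distance to the vertex. -/
lemma mul_norm_deriv_orbitAngle_le {m : ℕ} (hm : 0 < m) {z : ℝ → C3} {z' : C3} {U' : ℂ} {τ : ℝ}
    (hz : HasDerivAt z z' τ) (hU : HasDerivAt (fun s => orbitAngle (z s)) U' τ)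
    (hmem : ∀ s, z s ∈ torusCone m \ {0}) : m * ‖z τ‖ * ‖U'‖ ≤ ‖z'‖ := by
  have hex (s : ℝ) : ∃ w : ℂ, ‖orbitAngle (z s)‖ = 1 ∧ z s = coneMap m w (orbitAngle (z s)) := by
    obtain ⟨w, U, hw, hU, h⟩ := mem_torusCone_diff.1 (hmem s)
    have := orbitAngle_coneMap hm hw hU
    rw [← h] at this
    exact ⟨w, by rw [this, hU], by rw [this, h]⟩
  choose w hU1 hzw using hex
  have h0 := mul_norm_deriv_le (hz.apply_C3 0) hU hU1 (x := fun s => (w s).re) (n := m + 1)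
    (fun s => by conv_lhs => rw [hzw s, coneMap_zero_apply, mul_comm])
  have h1 := mul_norm_deriv_le (hz.apply_C3 1) hU hU1 (x := fun s => (w s).im) (n := m)
    (fun s => by conv_lhs => rw [hzw s, coneMap_one_apply, mul_comm])
  -- The factor `-I` cancels the `I` of the last coordinate, whose phase is a power of the conjugate
  -- angle.
  have h2 := mul_norm_deriv_le ((hz.apply_C3 2).const_mul (-I)) hU.star
    (fun s => by simpa using hU1 s) (x := fun s => coneHeight m (w s)) (n := 2 * m + 1)
    (fun s => by
      conv_lhs => rw [hzw s, coneMap_two_apply]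
      rw [starRingEnd_apply]
      linear_combination (-star (orbitAngle (z s)) ^ (2 * m + 1) * coneHeight m (w s)) * I_sq)
  simp only [norm_star, norm_mul, norm_neg, norm_I, one_mul] at h2
  -- All three weights are at least m in absolute value, so the squared estimates add up to the full
  -- norms.
  have hle (i : Fin 3) {n : ℕ} (hn : m ≤ n) (h : n * ‖z τ i‖ * ‖U'‖ ≤ ‖z' i‖) :
      (m * ‖z τ i‖ * ‖U'‖) ^ 2 ≤ ‖z' i‖ ^ 2 := by
    refine pow_le_pow_left₀ (by positivity) (le_trans ?_ h) 2
    gcongr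
  have h0' := hle 0 (Nat.le_succ m) h0
  have h1' := hle 1 le_rfl h1
  have h2' := hle 2 (by omega) h2
  refine le_of_sq_le_sq ?_ (norm_nonneg _)
  rw [mul_pow, mul_pow, EuclideanSpace.norm_sq_eq, EuclideanSpace.norm_sq_eq, Fin.sum_univ_three,
    Fin.sum_univ_three]
  linarith

/-! ### Non-isometric cones -/

/-- Logarithmic polar coordinates on the domain of `coneChart`. -/
def logPolar (y : EuclideanSpace ℝ (Fin 3)) : EuclideanSpace ℝ (Fin 3) :=
  !₂[Real.exp (y 0) * Real.cos (y 1), Real.exp (y 0) * Real.sin (y 1), y 2]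

lemma contDiff_logPolar : ContDiff ℝ ∞ logPolar := by
  have h (i) : ContDiff ℝ ∞ fun y : EuclideanSpace ℝ (Fin 3) => y i :=
    (contDiff_piLp 2).1 contDiff_id i
  refine (contDiff_piLp 2).2 fun i => ?_
  fin_cases i
  · exact (h 0).exp.mul (h 1).cos
  · exact (h 0).exp.mul (h 1).sin
  · exact h 2

lemma planeCoord_logPolar (y : EuclideanSpace ℝ (Fin 3)) :
    planeCoord (logPolar y) = Real.exp (y 0) * exp (y 1 * I) := by
  apply Complex.ext <;>
    simp [logPolar, exp_ofReal_mul_I_re, exp_ofReal_mul_I_im, -ofReal_exp]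

lemma norm_planeCoord_logPolar (y : EuclideanSpace ℝ (Fin 3)) :
    ‖planeCoord (logPolar y)‖ = Real.exp (y 0) := by
  rw [planeCoord_logPolar, norm_mul, norm_exp_ofReal_mul_I, mul_one, norm_real,
    Real.norm_of_nonneg (Real.exp_pos _).le]

lemma planeCoord_logPolar_ne_zero (y : EuclideanSpace ℝ (Fin 3)) :
    planeCoord (logPolar y) ≠ 0 := by
  rw [← norm_pos_iff, norm_planeCoord_logPolar]
  exact Real.exp_pos _

/-- Norm 1 forces 1/2 ≤ ‖w‖ ≤ 1, so the logarithm lies in [-1, 0]; both arguments are at most π ≤ 4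
in size, and 1 + 16 + 16 < 10². -/
lemma exists_logPolar_eq {m : ℕ} {p : C3} (hp : p ∈ torusCone m \ {0}) (hp1 : ‖p‖ = 1) :
    ∃ y ∈ Metric.closedBall (0 : EuclideanSpace ℝ (Fin 3)) 10, coneChart m (logPolar y) = p := by
  obtain ⟨w, U, hw, hU, rfl⟩ := mem_torusCone_diff.1 hp
  have hw0 : 0 < ‖w‖ := norm_pos_iff.2 hw
  have hw1 := norm_le_norm_coneMap m w hU
  have hw2 := norm_coneMap_le m w hU
  rw [hp1] at hw1 hw2
  refine ⟨!₂[Real.log ‖w‖, arg w, arg U], ?_, ?_⟩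
  · have hlog1 : Real.log ‖w‖ ≤ 0 := Real.log_nonpos hw0.le hw1
    have hlog2 : -1 ≤ Real.log ‖w‖ := by
      have := Real.one_sub_inv_le_log_of_pos hw0
      have : ‖w‖⁻¹ ≤ 2 := by rw [inv_le_comm₀ hw0 two_pos]; linarith
      linarith
    have ha := abs_arg_le_pi w
    have hb := abs_arg_le_pi U
    have hpi := Real.pi_le_four
    rw [mem_closedBall_zero_iff]
    refine le_of_sq_le_sq ?_ (by norm_num)
    rw [EuclideanSpace.norm_sq_eq, Fin.sum_univ_three]
    simp only [Matrix.cons_val, Real.norm_eq_abs]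
    have := abs_le.2 ⟨hlog2, hlog1.trans zero_le_one⟩
    nlinarith [abs_nonneg (arg w), abs_nonneg (arg U), abs_nonneg (Real.log ‖w‖)]
  · rw [coneChart, planeCoord_logPolar]
    congr 1
    · simp [Real.exp_log hw0, -ofReal_exp]
    · simpa [logPolar, hU] using norm_mul_exp_arg_mul_I U

/-- Only finitely many members of the family can be isometric to a given one. -/
lemma exists_bound_of_areIsometric {j : ℕ} (hj : 0 < j) :
    ∃ A : ℝ, ∀ k : ℕ, 0 < k → AreIsometric (torusCone j \ {0}) (torusCone k \ {0}) →
      (k : ℝ) ≤ A := by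
  -- In logarithmic polar coordinates the domain is all of ℝ³, so points can be joined by straight
  -- segments that miss the vertex.
  let Λ : EuclideanSpace ℝ (Fin 3) → C3 := coneChart j ∘ logPolar
  have hΛ : ContDiff ℝ ∞ Λ := contDiff_iff_contDiffAt.2 fun y =>
    (contDiffAt_coneChart hj (planeCoord_logPolar_ne_zero y)).comp y contDiff_logPolar.contDiffAt
  obtain ⟨B, hB⟩ :=
    (isCompact_closedBall (0 : EuclideanSpace ℝ (Fin 3)) 10).exists_bound_of_continuousOn
      (hΛ.continuous_fderiv (by simp)).continuousOn
  -- `B` bounds the differential of `Λ` on the ball, 20 is the diameter of the ball, and exp(-10)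
  -- bounds from below the distance to the vertex there; none depends on `k`.
  refine ⟨Real.exp 10 * (B * 20), fun k hk ⟨f, g, hf, hg, hfg⟩ => ?_⟩
  have hB0 : 0 ≤ B := (norm_nonneg _).trans (hB 0 (by simp))
  have hk0 : (0 : ℝ) < k := by exact_mod_cast hk
  -- Every angle occurs on the link of the target cone, and the inverse isometry keeps that point at
  -- distance 1 from the vertex.
  have hpt (V : Circle) : ∃ y ∈ Metric.closedBall (0 : EuclideanSpace ℝ (Fin 3)) 10,
      orbitAngle (f (Λ y)) = V := by
    have hP : linkTorus k (1, V) ∈ link (torusCone k) := by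
      rw [← range_linkTorus]
      exact mem_range_self _
    have hP1 : ‖linkTorus k (1, V)‖ = 1 := mem_sphere_zero_iff_norm.1 hP.2
    have hP' : linkTorus k (1, V) ∈ torusCone k \ {0} :=
      ⟨hP.1, fun h => by rw [mem_singleton_iff.1 h, norm_zero] at hP1; exact zero_ne_one hP1⟩
    obtain ⟨y, hy, hyp⟩ := exists_logPolar_eq (hg.1 hP')
      ((norm_map_eq hk hj hg hf hfg.symm hP').trans hP1)
    refine ⟨y, hy, ?_⟩
    change orbitAngle (f (coneChart j (logPolar y))) = V
    rw [hyp, hfg.2 hP']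
    exact congrArg Prod.snd (linkInv_linkTorus hk (1, V))
  obtain ⟨y₀, hy₀, h₀⟩ := hpt 1
  obtain ⟨y₁, hy₁, h₁⟩ := hpt (-1)
  let l : ℝ → EuclideanSpace ℝ (Fin 3) := fun s => y₀ + s • (y₁ - y₀)
  have hl (s : ℝ) : HasDerivAt l (y₁ - y₀) s := hasDerivAt_line _ _ s
  have hmem (s : ℝ) : Λ (l s) ∈ torusCone j \ {0} :=
    coneChart_mem_torusCone j (planeCoord_logPolar_ne_zero _)
  have hball {s : ℝ} (hs : s ∈ Icc (0 : ℝ) 1) : l s ∈ Metric.closedBall 0 10 :=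
    (convex_closedBall _ _).add_smul_sub_mem hy₀ hy₁ hs
  have hspeed (s : ℝ) (hs : s ∈ Icc (0 : ℝ) 1) :
      ∃ U', HasDerivAt (fun s => orbitAngle (f (Λ (l s)))) U' s ∧
        ‖U'‖ ≤ Real.exp 10 * (B * 20) / k := by
    have hzs : HasDerivAt (fun s => Λ (l s)) (fderiv ℝ Λ (l s) (y₁ - y₀)) s :=
      (hΛ.differentiable (by simp) (l s)).hasFDerivAt.comp_hasDerivAt s (hl s)
    have hcs : HasDerivAt (fun s => logPolar (l s)) (fderiv ℝ logPolar (l s) (y₁ - y₀)) s :=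
      (contDiff_logPolar.differentiable (by simp) (l s)).hasFDerivAt.comp_hasDerivAt s (hl s)
    obtain ⟨x', hx', hxn⟩ := hasDerivAt_comp_coneChart hj hf hcs
      (planeCoord_logPolar_ne_zero _) hzs
    change HasDerivAt (fun s => f (Λ (l s))) x' s at hx'
    have hreg : f (Λ (l s)) ∈ regularSet := by
      obtain ⟨w, U, hw, hU, h⟩ := mem_torusCone_diff.1 (hf.1 (hmem s))
      rw [h]
      exact coneMap_mem_regularSet hk hw hU
    have hUd : HasDerivAt (fun s => orbitAngle (f (Λ (l s))))
        (fderiv ℝ orbitAngle (f (Λ (l s))) x') s :=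
      HasFDerivAt.comp_hasDerivAt (f := fun s => f (Λ (l s))) s
        ((contDiffAt_orbitAngle hreg).differentiableAt (by simp)).hasFDerivAt hx'
    refine ⟨_, hUd, ?_⟩
    have hmain := mul_norm_deriv_orbitAngle_le hk hx' hUd (fun s => hf.1 (hmem s))
    have hr : Real.exp (-10) ≤ ‖f (Λ (l s))‖ := by
      rw [norm_map_eq hj hk hf hg hfg (hmem s)]
      have h1 := norm_le_norm_coneMap j (planeCoord (logPolar (l s)))
        (norm_exp_ofReal_mul_I (logPolar (l s) 2))
      rw [norm_planeCoord_logPolar] at h1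
      refine le_trans (Real.exp_le_exp.2 ?_) h1
      have h2 := (PiLp.norm_apply_le (l s) 0).trans (mem_closedBall_zero_iff.1 (hball hs))
      rw [Real.norm_eq_abs] at h2
      linarith [(abs_le.1 h2).1]
    have hdist : ‖y₁ - y₀‖ ≤ 20 := by
      have := norm_sub_le y₁ y₀
      linarith [mem_closedBall_zero_iff.1 hy₀, mem_closedBall_zero_iff.1 hy₁]
    have hz' : ‖x'‖ ≤ B * 20 := by
      rw [hxn]
      exact ((fderiv ℝ Λ (l s)).le_opNorm _).trans
        (mul_le_mul (hB _ (hball hs)) hdist (norm_nonneg _) hB0)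
    rw [le_div_iff₀ hk0]
    set N := ‖fderiv ℝ orbitAngle (f (Λ (l s))) x'‖
    have hN : 0 ≤ N := norm_nonneg _
    calc N * k = Real.exp 10 * (k * Real.exp (-10) * N) := by
          rw [Real.exp_neg]; field_simp
      _ ≤ Real.exp 10 * (k * ‖f (Λ (l s))‖ * N) := by gcongr
      _ ≤ Real.exp 10 * (B * 20) := mul_le_mul_of_nonneg_left (hmain.trans hz') (Real.exp_pos _).le
  choose! U' hU' using hspeed
  have hmv := (convex_Icc (0 : ℝ) 1).norm_image_sub_le_of_norm_hasDerivWithin_le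
    (fun s hs => (hU' s hs).1.hasDerivWithinAt) (fun s hs => (hU' s hs).2)
    (left_mem_Icc.2 zero_le_one) (right_mem_Icc.2 zero_le_one)
  have e0 : l 0 = y₀ := by simp [l]
  have e1 : l 1 = y₁ := by simp [l]
  rw [e0, e1, h₀, h₁] at hmv
  -- The angle must cross the chord from 1 to -1, of length 2, within unit time.
  have h2 : ‖((-1 : Circle) : ℂ) - ((1 : Circle) : ℂ)‖ = 2 := by
    rw [Circle.coe_neg, Circle.coe_one, show (-1 : ℂ) - 1 = -2 by norm_num, norm_neg]
    norm_num
  rw [h2, sub_zero, norm_one, mul_one, le_div_iff₀ hk0] at hmv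
  linarith

lemma AreIsometric.symm {M N : Set C3} (h : AreIsometric M N) : AreIsometric N M := by
  obtain ⟨f, g, hf, hg, hfg⟩ := h
  exact ⟨g, f, hg, hf, hfg.symm⟩

theorem theorem3 :
    ∃ C : ℕ → Set C3,
      (∀ k, IsSpecialLagrangianCone (C k) ∧ IsEmbeddedTorus (link (C k)) ∧
        IsCircleInvariant (link (C k))) ∧
      Pairwise fun j k => ¬ AreIsometric (C j \ {0}) (C k \ {0}) := by
  have hbound (j : ℕ) : ∃ n : ℕ, ∀ k, n ≤ k →
      ¬ AreIsometric (torusCone (j + 1) \ {0}) (torusCone (k + 1) \ {0}) := by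
    obtain ⟨A, hA⟩ := exists_bound_of_areIsometric j.succ_pos
    obtain ⟨n, hn⟩ := exists_nat_gt A
    refine ⟨n, fun k hk h => ?_⟩
    have h1 := hA (k + 1) k.succ_pos h
    have h2 : (n : ℝ) ≤ k := by exact_mod_cast hk
    push_cast at h1
    linarith
  choose b hb using hbound
  -- Each index is chosen beyond the bounds of all earlier ones; the reverse order is covered by
  -- symmetry of isometry.
  obtain ⟨φ, hφ⟩ : ∃ φ : ℕ → ℕ, ∀ i j, i < j → b (φ i) ≤ φ j := by
    obtain ⟨φ, -, h⟩ := exists_seq_of_forall_finset_exists (fun _ : ℕ => True)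
      (fun i j => b i ≤ j) (fun s _ => ⟨s.sup b, trivial, fun x hx => Finset.le_sup hx⟩)
    exact ⟨φ, h⟩
  refine ⟨fun k => torusCone (φ k + 1), fun k =>
    ⟨isSpecialLagrangianCone_torusCone (Nat.succ_pos _), isEmbeddedTorus_link (Nat.succ_pos _),
      isCircleInvariant_link _⟩, fun i j hij h => ?_⟩
  rcases lt_or_gt_of_ne hij with hlt | hlt
  · exact hb _ _ (hφ i j hlt) h
  · exact hb _ _ (hφ j i hlt) h.symm

end
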